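/- Let $X$ be a compact metric space with at least two points and let $f\colon X\to X$ be continuous. Assume that * $(X,f)$ is non-wandering: for every $x\in X$ and every neighbourhood $U$ of $x$ there is $k\ge 1$ with $f^k(U)\cap U\ne\emptyset$; * $(X,f)$ has the shadowing property: for every $\varepsilon>0$ there is $\delta>0$ such that for every sequence $(x_n)_{n\ge 0}$ in $X$ with $d(f(x_n),x_{n+1})<\delta$ for all $n\ge 0$ there is $z\in X$ with $d(f^n(z),x_n)<\varepsilon$ for all $n\ge 0$. Then the following conditions are equivalent: 1. $(X,f)$ is weakly mixing, i.e. $f\times f$ is transitive: for all non-empty open $U,V\subset X\times X$ there is $k\ge 1$ with $(f\times f)^k(U)\cap V\neq\emptyset$. 2. For every $d\ge 1$ and all non-empty open subsets $U_0,U_1,\dots,U_d$ of $X$ there exist an integer $m\ge 1$, a non-empty closed set $Y\subset X$ with $f^m(Y)\subset Y$, and a continuous surjection $\pi\colon Y\to\{0,1,\dots,d\}^{\mathbb{Z}_{\ge 0}}$ with $\pi\circ f^m|_Y=\sigma\circ\pi$, where $\sigma(\alpha)_n=\alpha_{n+1}$ is the shift, such that $\pi^{-1}(C[i])\subset U_i$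 for $i=0,1,\dots,d$, where $C[i]=\{\alpha:\alpha_0=i\}$. 3. $(X,f)$ has the strong Property P: for every $n\ge 2$ and all non-empty open subsets $U_0,\dots,U_{n-1}$ of $X$ there is an integer $N\ge 0$ such that for every $k\ge 2$ and every $s=(s(1),\dots,s(k))\in\{0,1,\dots,n-1\}^k$ there is $x\in X$ with $x\in U_{s(1)},\ f^{N}(x)\in U_{s(2)},\ \dots,\ f^{(k-1)N}(x)\in U_{s(k)}$. 4. $(X,f)$ has uniformly positive entropy of all orders: for every $n\ge 2$, every cover $\mathcal U$ of $X$ by $n$ non-dense open sets has positive entropy $h(f,\mathcal U)=\lim_{k\to\infty}\frac1k\log \mathcal N\bigl(\bigvee_{j=0}^{k-1}f^{-j}\mathcal U\bigr)$, where $\mathcal N(\mathcal V)$ is the minimal cardinality of a subcover of $\mathcal V$. -/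

import Mathlib

open Filter Topology Set

namespace TopDyn

section Basic

variable {X Y : Type*}

/-- The set of non-wandering points of `f`. -/
def nonWanderingSet [TopologicalSpace X] (f : X → X) : Set X :=
  {x | ∀ U ∈ 𝓝 x, ∃ k : ℕ, 1 ≤ k ∧ ((f^[k] '' U) ∩ U).Nonempty}

/-- The system is non-wandering: every point is non-wandering. -/
def NonWandering [TopologicalSpace X] (f : X → X) : Prop :=
  nonWanderingSet f = univ

/-- Topological transitivity: every non-empty open set reaches every other one in a positive
number of steps. -/
def Transitive [TopologicalSpace X] (f : X → X) : Prop :=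
  ∀ U V : Set X, IsOpen U → IsOpen V → U.Nonempty → V.Nonempty →
    ∃ k : ℕ, 1 ≤ k ∧ ((f^[k] '' U) ∩ V).Nonempty

/-- Weak mixing: `f × f` is transitive on `X × X`. -/
def WeaklyMixing [TopologicalSpace X] (f : X → X) : Prop :=
  Transitive (Prod.map f f)

/-- A (one-sided infinite) `δ`-pseudo orbit of `f`. -/
def IsPseudoOrbit [MetricSpace X] (f : X → X) (δ : ℝ) (x : ℕ → X) : Prop :=
  ∀ n, dist (f (x n)) (x (n + 1)) < δ

/-- The point `z` is `ε`-tracing the sequence `x`. -/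
def Traces [MetricSpace X] (f : X → X) (ε : ℝ) (z : X) (x : ℕ → X) : Prop :=
  ∀ n, dist (f^[n] z) (x n) < ε

/-- The shadowing (pseudo-orbit tracing) property. -/
def Shadowing [MetricSpace X] (f : X → X) : Prop :=
  ∀ ε > 0, ∃ δ > 0, ∀ x : ℕ → X, IsPseudoOrbit f δ x → ∃ z, Traces f ε z x

/-- `(A, g|_A)` is a subsystem of `(X, g)`: `A` is a non-empty closed invariant set. -/
structure IsSubsystem [TopologicalSpace X] (g : X → X) (A : Set X) : Prop where
  nonempty : A.Nonempty
  isClosed : IsClosed A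
  mapsTo : MapsTo g A A

/-- `π` is a factor map from `(X, f)` onto `(Y, g)`. -/
structure IsFactorMap [TopologicalSpace X] [TopologicalSpace Y] (f : X → X) (g : Y → Y)
    (π : X → Y) : Prop where
  continuous : Continuous π
  surjective : Function.Surjective π
  semiconj : π ∘ f = g ∘ π

end Basic

section Shift

/-- The space `{0, …, d}^ℕ`, with the product of the discrete topologies. -/
abbrev ShiftSpace (d : ℕ) : Type := ℕ → Fin (d + 1)

/-- The shift map of the full shift on `d + 1` symbols. -/
def shift (d : ℕ) : ShiftSpace d → ShiftSpace d := fun a n => a (n + 1)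

/-- The cylinder set `C[i]`. -/
def cylinder {d : ℕ} (i : Fin (d + 1)) : Set (ShiftSpace d) := {a | a 0 = i}

/-- For all non-empty open `U₀, …, U_d` (`d ≥ 1`) some subsystem of some power `f^m` (`m ≥ 1`)
factors onto the full shift on `d + 1` symbols, with the preimage of `C[i]` inside `U_i`. -/
def HasFullShiftFactors {X : Type*} [TopologicalSpace X] (f : X → X) : Prop :=
  ∀ d : ℕ, 1 ≤ d → ∀ U : Fin (d + 1) → Set X, (∀ i, IsOpen (U i)) → (∀ i, (U i).Nonempty) →
    ∃ m : ℕ, 1 ≤ m ∧ ∃ (A : Set X) (hA : IsSubsystem f^[m] A) (π : A → ShiftSpace d),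
      IsFactorMap (hA.mapsTo.restrict f^[m] A A) (shift d) π ∧
        ∀ i, Subtype.val '' (π ⁻¹' cylinder i) ⊆ U i

end Shift

/-- The strong Property P. -/
def StrongPropertyP {X : Type*} [TopologicalSpace X] (f : X → X) : Prop :=
  ∀ n : ℕ, 2 ≤ n → ∀ U : Fin n → Set X, (∀ i, IsOpen (U i)) → (∀ i, (U i).Nonempty) →
    ∃ N : ℕ, ∀ k : ℕ, 2 ≤ k → ∀ s : Fin k → Fin n,
      ∃ x : X, ∀ j : Fin k, f^[(j : ℕ) * N] x ∈ U (s j)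

section Entropy

variable {X ι : Type*}

/-- The join `𝒰 ∨ f⁻¹𝒰 ∨ ⋯ ∨ f^{-(k-1)}𝒰` of a cover `𝒰 = (U i)`, indexed by words of length
`k`. -/
def iteratedJoin (f : X → X) (U : ι → Set X) (k : ℕ) : (Fin k → ι) → Set X :=
  fun s => ⋂ j : Fin k, f^[(j : ℕ)] ⁻¹' U (s j)

/-- The minimal cardinality of a finite subcover of the cover `V`. -/
noncomputable def minSubcover {κ : Type*} (V : κ → Set X) : ℕ :=
  sInf {c | ∃ S : Finset κ, S.card = c ∧ ⋃ s ∈ S, V s = univ}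

/-- The topological entropy of `f` with respect to the open cover `U`: the exponential growth
rate of the minimal cardinality of a subcover of the iterated joins. For a continuous map and an
open cover of a compact space the logarithms are subadditive in `k`, so that the upper limit is
a limit. -/
noncomputable def coverEntropy (f : X → X) (U : ι → Set X) : EReal :=
  limsup (fun k : ℕ => ((Real.log (minSubcover (iteratedJoin f U k)) / k : ℝ) : EReal)) atTop

/-- Uniformly positive entropy of all orders: for `n ≥ 2`, each cover of the space by `n`
non-dense open sets has positive entropy. -/
def UniformlyPositiveEntropyOfAllOrders [TopologicalSpace X] (f : X → X) : Prop :=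
  ∀ n : ℕ, 2 ≤ n → ∀ U : Fin n → Set X, (∀ i, IsOpen (U i)) → (∀ i, ¬ Dense (U i)) →
    ⋃ i, U i = univ → 0 < coverEntropy f U

end Entropy

end TopDyn

/-! The proof is the cycle 1 → 2 → 3 → 4 → 1; shadowing enters in 1 → 2 and non-wandering in 4 → 1.
1 → 2: By Furstenberg's lemma one time `m` carries each of finitely many small balls, centred at
distinct points of the `U i`, into each other. Every symbol sequence then gives a pseudo-orbit made
of segments of length `m`, and tracing points realise all itineraries through disjoint closed balls.
2 → 3: Points over prescribed sequences have the required visits. 3 → 4: Property P for the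
complements of the closures gives, for each of the `n ^ k` words, a point avoiding the named cover
elements. A member of the join contains the points of at most `(n - 1) ^ k` words, so the entropy is
at least `log (n / (n - 1)) / N`. 4 → 1: If Petersen's criterion fails for `U`, `V`, disjoint closed
balls in them give a two-element cover whose joins have subcovers of linear size, hence zero
entropy. -/

namespace TopDyn

/-! ### Hitting times and criteria for weak mixing -/

section HittingTimes

variable {X : Type*} {f : X → X}

/-- The times at which some point of `U` is in `V`. -/
def hittingTimes (f : X → X) (U V : Set X) : Set ℕ := {k | ∃ x ∈ U, f^[k] x ∈ V}

theorem hittingTimes_mono {U U' V V' : Set X} (hU : U ⊆ U') (hV : V ⊆ V') :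
    hittingTimes f U V ⊆ hittingTimes f U' V' :=
  fun _ ⟨x, hx, hk⟩ => ⟨x, hU hx, hV hk⟩

/-- A witness `x` for the intersected pair serves the first pair, and `f^[a] x` serves the second at
the same time. -/
theorem hittingTimes_inter_subset (a : ℕ) (U U' V V' : Set X) :
    hittingTimes f (U ∩ f^[a] ⁻¹' U') (V ∩ f^[a] ⁻¹' V') ⊆
      hittingTimes f U V ∩ hittingTimes f U' V' := by
  rintro k ⟨x, ⟨hx, hx'⟩, hk, hk'⟩
  refine ⟨⟨x, hx, hk⟩, f^[a] x, hx', ?_⟩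
  rwa [← Function.iterate_add_apply, Nat.add_comm, Function.iterate_add_apply]

variable [TopologicalSpace X]

theorem weaklyMixing_iff :
    WeaklyMixing f ↔ ∀ U U' V V' : Set X, IsOpen U → IsOpen U' → IsOpen V → IsOpen V' →
      U.Nonempty → U'.Nonempty → V.Nonempty → V'.Nonempty →
      ∃ k, 1 ≤ k ∧ k ∈ hittingTimes f U V ∧ k ∈ hittingTimes f U' V' := by
  constructor
  · intro h U U' V V' hU hU' hV hV' nU nU' nV nV'
    obtain ⟨k, hk, _, ⟨⟨x, y⟩, hxy, rfl⟩, h2⟩ :=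
      h (U ×ˢ U') (V ×ˢ V') (hU.prod hU') (hV.prod hV') (nU.prod nU') (nV.prod nV')
    rw [Prod.map_iterate] at h2
    exact ⟨k, hk, ⟨x, hxy.1, h2.1⟩, y, hxy.2, h2.2⟩
  · rintro h U V hU hV ⟨⟨a, b⟩, hab⟩ ⟨⟨c, e⟩, hce⟩
    obtain ⟨U₁, U₂, hU₁, hU₂, ha, hb, hUs⟩ := isOpen_prod_iff.1 hU a b hab
    obtain ⟨V₁, V₂, hV₁, hV₂, hc, he, hVs⟩ := isOpen_prod_iff.1 hV c e hce
    obtain ⟨k, hk, ⟨x, hx, hx'⟩, y, hy, hy'⟩ :=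
      h U₁ U₂ V₁ V₂ hU₁ hU₂ hV₁ hV₂ ⟨a, ha⟩ ⟨b, hb⟩ ⟨c, hc⟩ ⟨e, he⟩
    refine ⟨k, hk, _, ⟨(x, y), hUs ⟨hx, hy⟩, rfl⟩, hVs ?_⟩
    rw [Prod.map_iterate]
    exact ⟨hx', hy'⟩

/-- In a weakly mixing system the sets of hitting times form a filter base (Furstenberg). -/
theorem WeaklyMixing.exists_hittingTimes_subset (h : WeaklyMixing f) (hf : Continuous f)
    {ι : Type*} (s : Finset ι) (U V : ι → Set X) (hU : ∀ i, IsOpen (U i))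
    (hV : ∀ i, IsOpen (V i)) (nU : ∀ i, (U i).Nonempty) (nV : ∀ i, (V i).Nonempty)
    [Nonempty X] :
    ∃ U' V' : Set X, IsOpen U' ∧ IsOpen V' ∧ U'.Nonempty ∧ V'.Nonempty ∧
      ∀ i ∈ s, hittingTimes f U' V' ⊆ hittingTimes f (U i) (V i) := by
  classical
  induction s using Finset.induction_on with
  | empty => exact ⟨univ, univ, isOpen_univ, isOpen_univ, univ_nonempty, univ_nonempty, by simp⟩
  | insert i s _ ih =>
    obtain ⟨U', V', hU', hV', nU', nV', hs⟩ := ih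
    obtain ⟨a, -, ⟨x, hx, hx'⟩, y, hy, hy'⟩ := weaklyMixing_iff.1 h (U i) (V i) U' V'
      (hU i) (hV i) hU' hV' (nU i) (nV i) nU' nV'
    refine ⟨U i ∩ f^[a] ⁻¹' U', V i ∩ f^[a] ⁻¹' V', (hU i).inter (hU'.preimage (hf.iterate a)),
      (hV i).inter (hV'.preimage (hf.iterate a)), ⟨x, hx, hx'⟩, ⟨y, hy, hy'⟩, fun j hj => ?_⟩
    have key := hittingTimes_inter_subset (f := f) a (U i) U' (V i) V'
    rcases Finset.mem_insert.1 hj with rfl | hj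
    · exact fun k hk => (key hk).1
    · exact fun k hk => hs j hj (key hk).2

theorem WeaklyMixing.exists_forall_mem_hittingTimes (h : WeaklyMixing f) (hf : Continuous f)
    {ι : Type*} [Finite ι] (U V : ι → Set X) (hU : ∀ i, IsOpen (U i))
    (hV : ∀ i, IsOpen (V i)) (nU : ∀ i, (U i).Nonempty) (nV : ∀ i, (V i).Nonempty)
    [Nonempty X] : ∃ k, 1 ≤ k ∧ ∀ i, k ∈ hittingTimes f (U i) (V i) := by
  have := Fintype.ofFinite ι
  obtain ⟨U', V', hU', hV', nU', nV', hs⟩ :=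
    h.exists_hittingTimes_subset hf Finset.univ U V hU hV nU nV
  obtain ⟨k, hk, hk', -⟩ := weaklyMixing_iff.1 h U' U' V' V' hU' hU' hV' hV' nU' nU' nV' nV'
  exact ⟨k, hk, fun i => hs i (Finset.mem_univ i) hk'⟩

/-- A finite open set would have isolated points, but if `{x}` were open, one time would carry `x`
both to `x` and away from it. -/
theorem WeaklyMixing.infinite_of_isOpen [T1Space X] [Nontrivial X] (h : WeaklyMixing f)
    {U : Set X} (hU : IsOpen U) (nU : U.Nonempty) : U.Infinite := by
  have hiso : ∀ x : X, ¬ IsOpen ({x} : Set X) := by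
    intro x hx
    obtain ⟨y, hy⟩ := exists_ne x
    obtain ⟨k, -, ⟨a, rfl, ha⟩, b, rfl, hb⟩ := weaklyMixing_iff.1 h {x} {x} {x} {x}ᶜ hx hx hx
      isOpen_compl_singleton (singleton_nonempty x) (singleton_nonempty x)
      (singleton_nonempty x) ⟨y, hy⟩
    exact hb ha
  obtain ⟨x, hx⟩ := nU
  intro hfin
  refine hiso x ?_
  have : ({x} : Set X) = U ∩ (U \ {x})ᶜ := by
    ext y
    simp only [mem_singleton_iff, mem_inter_iff, mem_compl_iff, Set.mem_sdiff, not_and, not_not]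
    exact ⟨fun h => h.symm ▸ ⟨hx, fun _ => rfl⟩, fun h => h.2 h.1⟩
  rw [this]
  exact hU.inter (hfin.subset sdiff_subset).isClosed.isOpen_compl

theorem NonWandering.surjective [CompactSpace X] [T2Space X] (h : NonWandering f)
    (hf : Continuous f) : Function.Surjective f := by
  intro x
  by_contra hx
  have hU : (range f)ᶜ ∈ 𝓝 x :=
    (isCompact_range hf).isClosed.isOpen_compl.mem_nhds hx
  have hx' : x ∈ nonWanderingSet f := h ▸ mem_univ x
  obtain ⟨k, hk, _, ⟨y, -, rfl⟩, hy⟩ := hx' _ hU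
  obtain ⟨k, rfl⟩ := Nat.exists_eq_add_of_le' hk
  exact hy ⟨f^[k] y, (Function.iterate_succ_apply' f k y).symm⟩

/-- Petersen's criterion for weak mixing. -/
theorem weaklyMixing_of_hittingTimes_inter (hf : Continuous f) (hs : Function.Surjective f)
    (h : ∀ U V : Set X, IsOpen U → IsOpen V → U.Nonempty → V.Nonempty →
      ∃ k, 1 ≤ k ∧ k ∈ hittingTimes f U U ∧ k ∈ hittingTimes f U V) : WeaklyMixing f := by
  have two : ∀ U V V' : Set X, IsOpen U → IsOpen V → IsOpen V' → U.Nonempty → V.Nonempty →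
      V'.Nonempty → ∃ k, 1 ≤ k ∧ k ∈ hittingTimes f U V ∧ k ∈ hittingTimes f U V' := by
    intro U V V' hU hV hV' nU nV nV'
    obtain ⟨a, -, -, x, hx, hxa⟩ := h U V hU hV nU nV
    -- A return to `U ∩ f^[a] ⁻¹' V` at time `n` is a visit to `V` at time `a + n`. Surjectivity
    -- makes `f^[a] ⁻¹' V'` non-empty.
    obtain ⟨n, hn, ⟨y, hy, hyn⟩, z, hz, hzn⟩ := h (U ∩ f^[a] ⁻¹' V) (f^[a] ⁻¹' V')
      (hU.inter (hV.preimage (hf.iterate a))) (hV'.preimage (hf.iterate a)) ⟨x, hx, hxa⟩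
      (nV'.preimage (hs.iterate a))
    refine ⟨a + n, by omega, ⟨y, hy.1, ?_⟩, z, hz.1, ?_⟩
    · rw [Function.iterate_add_apply]
      exact hyn.2
    · rw [Function.iterate_add_apply]
      exact hzn
  refine weaklyMixing_iff.2 fun U U' V V' hU hU' hV hV' nU nU' nV nV' => ?_
  obtain ⟨a, -, -, x, hx, hxa⟩ := h U U' hU hU' nU nU'
  -- Two sources reduce to one: a point of `U ∩ f^[a] ⁻¹' U'` lies in `U`, and its image under
  -- `f^[a]` lies in `U'`.
  obtain ⟨n, hn, ⟨y, hy, hyn⟩, z, hz, hzn⟩ := two (U ∩ f^[a] ⁻¹' U') V (f^[a] ⁻¹' V')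
    (hU.inter (hU'.preimage (hf.iterate a))) hV (hV'.preimage (hf.iterate a)) ⟨x, hx, hxa⟩ nV
    (nV'.preimage (hs.iterate a))
  refine ⟨n, hn, ⟨y, hy.1, hyn⟩, f^[a] z, hz.2, ?_⟩
  rwa [← Function.iterate_add_apply, Nat.add_comm, Function.iterate_add_apply]

end HittingTimes

/-! ### Full shift factors from shadowing -/

section FullShift

/-- A map whose orbits realise all itineraries through disjoint closed sets has a subsystem that
factors onto the full shift. -/
theorem exists_isFactorMap_shift {X : Type*} [TopologicalSpace X] {g : X → X} (hg : Continuous g)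
    {d : ℕ} {K : Fin (d + 1) → Set X} (hK : ∀ i, IsClosed (K i))
    (hdisj : Pairwise (Function.onFun Disjoint K))
    (hreal : ∀ a : ShiftSpace d, ∃ z, ∀ n, g^[n] z ∈ K (a n)) :
    ∃ (A : Set X) (hA : IsSubsystem g A) (π : A → ShiftSpace d),
      IsFactorMap (hA.mapsTo.restrict g A A) (shift d) π ∧
        ∀ i, Subtype.val '' (π ⁻¹' cylinder i) ⊆ K i := by
  have huniq : ∀ {x i j}, x ∈ K i → x ∈ K j → i = j := by
    intro x i j hi hj
    by_contra hij
    exact disjoint_left.1 (hdisj hij) hi hj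
  let A : Set X := {y | ∀ n, ∃ i, g^[n] y ∈ K i}
  have hA : IsSubsystem g A := by
    refine ⟨?_, ?_, fun y hy n => ?_⟩
    · obtain ⟨z, hz⟩ := hreal fun _ => 0
      exact ⟨z, fun n => ⟨_, hz n⟩⟩
    · have : A = ⋂ n, g^[n] ⁻¹' ⋃ i, K i := by
        ext y
        simp [A]
      rw [this]
      exact isClosed_iInter fun n => (isClosed_iUnion_of_finite hK).preimage (hg.iterate n)
    · rw [← Function.iterate_succ_apply]
      exact hy (n + 1)
  -- `π` is the itinerary; disjointness of the `K i` makes it independent of the choice.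
  choose π hπ using fun y : A => y.2
  refine ⟨A, hA, π, ⟨continuous_pi fun n => ?_, fun a => ?_, ?_⟩, ?_⟩
  · rw [continuous_discrete_rng]
    intro b
    have : (fun y => π y n) ⁻¹' {b} =
        ((fun y : A => g^[n] y) ⁻¹' ⋃ i : {i // i ≠ b}, K i)ᶜ := by
      ext y
      simp only [mem_preimage, mem_singleton_iff, mem_compl_iff, mem_iUnion, not_exists]
      constructor
      · rintro rfl ⟨i, hi⟩ h
        exact hi (huniq h (hπ y n))
      · intro h
        by_contra hne
        exact h ⟨_, hne⟩ (hπ y n)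
    rw [this]
    exact ((isClosed_iUnion_of_finite fun i : {i // i ≠ b} => hK i).preimage
      ((hg.iterate n).comp continuous_subtype_val)).isOpen_compl
  · obtain ⟨z, hz⟩ := hreal a
    exact ⟨⟨z, fun n => ⟨_, hz n⟩⟩, funext fun n => huniq (hπ _ n) (hz n)⟩
  · funext y n
    refine huniq (hπ _ n) ?_
    have := hπ y (n + 1)
    rwa [Function.iterate_succ_apply] at this
  · rintro i _ ⟨y, rfl, rfl⟩
    exact hπ y 0

/-- Hall's marriage theorem applies to subsets of size `card ι`: any non-empty family of them
already has a union of at least that size. -/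
theorem exists_injective_forall_mem_of_infinite {X ι : Type*} [Finite ι] (U : ι → Set X)
    (hU : ∀ i, (U i).Infinite) : ∃ p : ι → X, Function.Injective p ∧ ∀ i, p i ∈ U i := by
  classical
  have := Fintype.ofFinite ι
  choose T hT hcard using fun i => (hU i).exists_subset_card_eq (Fintype.card ι)
  obtain ⟨p, hp, hpT⟩ := (Finset.all_card_le_biUnion_card_iff_exists_injective T).1 fun s => by
    rcases s.eq_empty_or_nonempty with rfl | ⟨i, hi⟩
    · simp
    · calc s.card ≤ Fintype.card ι := s.card_le_univ
        _ = (T i).card := (hcard i).symm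
        _ ≤ _ := Finset.card_le_card (Finset.subset_biUnion_of_mem T hi)
  exact ⟨p, hp, fun i => hT i (hpT i)⟩

theorem exists_closedBall_subset_and_disjoint {X ι : Type*} [MetricSpace X] [Finite ι]
    {U : ι → Set X} (hU : ∀ i, IsOpen (U i)) {p : ι → X} (hp : Function.Injective p)
    (hpU : ∀ i, p i ∈ U i) :
    ∃ r > 0, (∀ i, Metric.closedBall (p i) r ⊆ U i) ∧
      Pairwise (Function.onFun Disjoint fun i => Metric.closedBall (p i) r) := by
  have h1 : ∀ i, ∀ᶠ r in 𝓝[>] (0 : ℝ), Metric.closedBall (p i) r ⊆ U i := fun i => by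
    obtain ⟨e, he, hs⟩ := Metric.nhds_basis_closedBall.mem_iff.1 ((hU i).mem_nhds (hpU i))
    filter_upwards [Ioo_mem_nhdsGT he] with r hr
    exact (Metric.closedBall_subset_closedBall hr.2.le).trans hs
  have h2 : ∀ i j, ∀ᶠ r in 𝓝[>] (0 : ℝ),
      i ≠ j → Disjoint (Metric.closedBall (p i) r) (Metric.closedBall (p j) r) := fun i j => by
    by_cases hij : i = j
    · exact Eventually.of_forall fun _ h => absurd hij h
    have hd : 0 < dist (p i) (p j) / 2 := half_pos (dist_pos.2 (hp.ne hij))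
    filter_upwards [Ioo_mem_nhdsGT hd] with r hr _
    exact Metric.closedBall_disjoint_closedBall (by linarith [hr.2])
  obtain ⟨r, ⟨hr1, hr2⟩, hr0⟩ := (((eventually_all.2 h1).and
    (eventually_all.2 fun i => eventually_all.2 (h2 i))).and self_mem_nhdsWithin).exists
  exact ⟨r, hr0, hr1, fun i j => hr2 i j⟩

/-- Concatenating orbit segments of length `m` gives a pseudo-orbit, if each segment ends close
to the beginning of the next. -/
theorem isPseudoOrbit_concat {X : Type*} [MetricSpace X] {f : X → X} {δ : ℝ} (hδ : 0 < δ)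
    {m : ℕ} (hm : 1 ≤ m) {y : ℕ → X} (hy : ∀ n, dist (f^[m] (y n)) (y (n + 1)) < δ) :
    IsPseudoOrbit f δ fun q => f^[q % m] (y (q / m)) := by
  intro q
  simp only
  rw [← Function.iterate_succ_apply' f]
  have hlt := Nat.mod_lt q hm
  have hq := Nat.div_add_mod q m
  rcases Nat.lt_or_ge (q % m + 1) m with h | h
  · have e : q + 1 = m * (q / m) + (q % m + 1) := by omega
    have h1 : (q + 1) % m = q % m + 1 := by
      rw [e, Nat.mul_add_mod, Nat.mod_eq_of_lt h]
    have h2 : (q + 1) / m = q / m := by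
      rw [e, Nat.mul_add_div hm, Nat.div_eq_of_lt h, Nat.add_zero]
    rw [h1, h2, Nat.succ_eq_add_one, dist_self]
    exact hδ
  · have h0 : q % m + 1 = m := by omega
    have e : q + 1 = m * (q / m + 1) := by
      rw [Nat.mul_succ]
      omega
    have h1 : (q + 1) % m = 0 := by rw [e, Nat.mul_mod_right]
    have h2 : (q + 1) / m = q / m + 1 := by rw [e, Nat.mul_div_cancel_left _ hm]
    rw [h1, h2, Nat.succ_eq_add_one, h0]
    exact hy _

theorem WeaklyMixing.hasFullShiftFactors {X : Type*} [MetricSpace X] [Nontrivial X] {f : X → X}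
    (h : WeaklyMixing f) (hf : Continuous f) (hsh : Shadowing f) : HasFullShiftFactors f := by
  intro d _ U hU nU
  obtain ⟨p, hp, hpU⟩ := exists_injective_forall_mem_of_infinite U
    fun i => h.infinite_of_isOpen (hU i) (nU i)
  obtain ⟨r, hr, hrU, hdisj⟩ := exists_closedBall_subset_and_disjoint hU hp hpU
  obtain ⟨δ, hδ, hshδ⟩ := hsh (r / 2) (half_pos hr)
  -- The bound `r / 2` leaves room for the tracing error inside the ball of radius `r`. The bound `δ
  -- / 2` is used twice, on both sides of the centre `p (a (n + 1))` at each junction.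
  let η := min (r / 2) (δ / 2)
  have hη : 0 < η := lt_min (half_pos hr) (half_pos hδ)
  obtain ⟨m, hm, hhit⟩ := h.exists_forall_mem_hittingTimes hf
    (fun q : Fin (d + 1) × Fin (d + 1) => Metric.ball (p q.1) η)
    (fun q => Metric.ball (p q.2) η) (fun _ => Metric.isOpen_ball) (fun _ => Metric.isOpen_ball)
    (fun _ => Metric.nonempty_ball.2 hη) (fun _ => Metric.nonempty_ball.2 hη)
  choose y hy hym using hhit
  simp only [Metric.mem_ball] at hy hym
  have hη1 : η ≤ r / 2 := min_le_left _ _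
  have hη2 : η ≤ δ / 2 := min_le_right _ _
  obtain ⟨A, hA, π, hπ, hsub⟩ := exists_isFactorMap_shift (hf.iterate m)
    (K := fun i => Metric.closedBall (p i) r) (fun _ => Metric.isClosed_closedBall) hdisj
    fun a => by
      obtain ⟨z, hz⟩ := hshδ _ (isPseudoOrbit_concat (f := f) hδ hm
        (y := fun n => y (a n, a (n + 1))) fun n => by
          have h1 := hym (a n, a (n + 1))
          have h2 := hy (a (n + 1), a (n + 2))
          have h3 := dist_triangle_right (f^[m] (y (a n, a (n + 1))))
            (y (a (n + 1), a (n + 2))) (p (a (n + 1)))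
          exact h3.trans_lt (by linarith))
      refine ⟨z, fun n => ?_⟩
      have h1 := hz (m * n)
      simp only [Nat.mul_mod_right, Nat.mul_div_cancel_left _ hm, Function.iterate_zero,
        id_eq] at h1
      have h2 := hy (a n, a (n + 1))
      rw [← Function.iterate_mul, Metric.mem_closedBall]
      have h3 := dist_triangle (f^[m * n] z) (y (a n, a (n + 1))) (p (a n))
      simp only at h2
      linarith
  exact ⟨m, hm, A, hA, π, hπ, fun i => (hsub i).trans (hrU i)⟩

theorem HasFullShiftFactors.strongPropertyP {X : Type*} [TopologicalSpace X] {f : X → X}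
    (h : HasFullShiftFactors f) : StrongPropertyP f := by
  intro n hn U hU nU
  obtain ⟨d, rfl⟩ := Nat.exists_eq_add_of_le' (by omega : 1 ≤ n)
  obtain ⟨m, -, A, hA, π, hπ, hsub⟩ := h d (by omega) U hU nU
  refine ⟨m, fun k _ s => ?_⟩
  -- The finite word is padded with zeros.
  obtain ⟨z, hz⟩ := hπ.surjective fun j => if hj : j < k then s ⟨j, hj⟩ else 0
  refine ⟨z, fun j => ?_⟩
  set g := hA.mapsTo.restrict f^[m] A A with hg
  have hval : ∀ n, ((g^[n] z : A) : X) = f^[n * m] z := by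
    intro n
    rw [Nat.mul_comm, Function.iterate_mul, hg, MapsTo.iterate_restrict]
    rfl
  have hshift : ∀ n (a : ShiftSpace d), ((shift d)^[n] a) 0 = a n := by
    intro n
    induction n with
    | zero => exact fun _ => rfl
    | succ n ih =>
      intro a
      rw [Function.iterate_succ_apply, ih]
      rfl
  have hsemi : Function.Semiconj π g (shift d) := fun x => congrFun hπ.semiconj x
  rw [← hval]
  refine hsub _ ⟨_, ?_, rfl⟩
  change π (g^[(j : ℕ)] z) 0 = s j
  rw [(hsemi.iterate_right j).eq z, hshift, hz]
  simp

end FullShift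

/-! ### Entropy of covers -/

section Entropy

variable {X : Type*} {f : X → X}

theorem minSubcover_le {κ : Type*} {V : κ → Set X} (S : Finset κ) (hS : ⋃ s ∈ S, V s = univ) :
    minSubcover V ≤ S.card :=
  Nat.sInf_le ⟨S, rfl, hS⟩

theorem exists_card_eq_minSubcover {κ : Type*} [Finite κ] {V : κ → Set X}
    (hV : ⋃ s, V s = univ) :
    ∃ S : Finset κ, S.card = minSubcover V ∧ ⋃ s ∈ S, V s = univ := by
  have := Fintype.ofFinite κ
  exact Nat.sInf_mem (s := {c | ∃ S : Finset κ, S.card = c ∧ ⋃ s ∈ S, V s = univ})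
    ⟨_, Finset.univ, rfl, by simpa using hV⟩

theorem iUnion_iteratedJoin {ι : Type*} {U : ι → Set X} (hU : ⋃ i, U i = univ) (k : ℕ) :
    ⋃ s, iteratedJoin f U k s = univ := by
  refine eq_univ_of_forall fun x => ?_
  choose s hs using fun j : Fin k => mem_iUnion.1 (hU.symm ▸ mem_univ (f^[(j : ℕ)] x))
  exact mem_iUnion.2 ⟨s, mem_iInter.2 hs⟩

/-- If the points avoiding prescribed elements of the cover at the times `0, N, …, (k - 1) N`
exist for all prescriptions, then the iterated join has no small subcover. -/
theorem pow_le_pow_mul_minSubcover {n N k : ℕ} {U : Fin n → Set X} (hU : ⋃ i, U i = univ)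
    (hN : 1 ≤ N) (h : ∀ s : Fin k → Fin n, ∃ x, ∀ j : Fin k, f^[(j : ℕ) * N] x ∉ U (s j)) :
    n ^ k ≤ (n - 1) ^ k * minSubcover (iteratedJoin f U (k * N)) := by
  classical
  obtain ⟨S, hS, hcov⟩ := exists_card_eq_minSubcover (iUnion_iteratedJoin (f := f) hU (k * N))
  rw [← hS]
  choose x hx using h
  have hidx : ∀ j : Fin k, (j : ℕ) * N < k * N := fun j => Nat.mul_lt_mul_of_pos_right j.2 hN
  let T : (Fin (k * N) → Fin n) → Finset (Fin k → Fin n) := fun w =>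
    Fintype.piFinset fun j => Finset.univ.erase (w ⟨j * N, hidx j⟩)
  have hsub : (Finset.univ : Finset (Fin k → Fin n)) ⊆ S.biUnion T := by
    intro s _
    have hxs : x s ∈ ⋃ w ∈ S, iteratedJoin f U (k * N) w := hcov ▸ mem_univ _
    obtain ⟨w, hw, hxw⟩ := mem_iUnion₂.1 hxs
    refine Finset.mem_biUnion.2 ⟨w, hw, Fintype.mem_piFinset.2 fun j => ?_⟩
    refine Finset.mem_erase.2 ⟨fun hsj => hx s j ?_, Finset.mem_univ _⟩
    rw [hsj]
    exact mem_iInter.1 hxw ⟨j * N, hidx j⟩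
  have h1 := (Finset.card_le_card hsub).trans Finset.card_biUnion_le
  have h2 : ∀ w, (T w).card = (n - 1) ^ k := fun w => by
    simp [T, Fintype.card_piFinset, Finset.card_erase_of_mem]
  simp only [h2, Finset.sum_const, smul_eq_mul] at h1
  simpa [mul_comm] using h1

theorem StrongPropertyP.uniformlyPositiveEntropyOfAllOrders [TopologicalSpace X]
    (h : StrongPropertyP f) : UniformlyPositiveEntropyOfAllOrders f := by
  intro n hn U _ hnd hcov
  obtain ⟨N, hNs⟩ := h n hn (fun i => (closure (U i))ᶜ) (fun i => isClosed_closure.isOpen_compl)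
    fun i => by
      rw [nonempty_compl, Ne, ← dense_iff_closure_eq]
      exact hnd i
  have havoid : ∀ k, 2 ≤ k → ∀ s : Fin k → Fin n, ∃ x, ∀ j : Fin k,
      f^[(j : ℕ) * N] x ∉ U (s j) := fun k hk s => by
    obtain ⟨x, hx⟩ := hNs k hk s
    exact ⟨x, fun j hj => hx j (subset_closure hj)⟩
  -- With `N = 0`, the word listing all indices would give a point outside every element of the
  -- cover.
  have hN : 1 ≤ N := by
    by_contra h0
    obtain rfl : N = 0 := by omega
    obtain ⟨x, hx⟩ := havoid n hn id
    obtain ⟨i, hi⟩ := mem_iUnion.1 (hcov.symm ▸ mem_univ x)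
    exact hx i hi
  have hn1 : (0 : ℝ) < ((n - 1 : ℕ) : ℝ) := by exact_mod_cast (by omega : 0 < n - 1)
  have hn0 : (0 : ℝ) < n := by exact_mod_cast (by omega : 0 < n)
  set c : ℝ := Real.log (n / (n - 1 : ℕ)) with hc
  have hc0 : 0 < c := by
    refine Real.log_pos ((one_lt_div hn1).2 ?_)
    exact_mod_cast (by omega : n - 1 < n)
  have hNR : (0 : ℝ) < N := by exact_mod_cast hN
  have hbound : ∀ k, 2 ≤ k → c / N ≤
      Real.log (minSubcover (iteratedJoin f U (k * N))) / (k * N : ℕ) := fun k hk => by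
    have h1 : ((n : ℝ)) ^ k ≤ ((n - 1 : ℕ) : ℝ) ^ k *
        minSubcover (iteratedJoin f U (k * N)) := by
      exact_mod_cast pow_le_pow_mul_minSubcover hcov hN (havoid k hk)
    have h2 : ((n : ℝ) / (n - 1 : ℕ)) ^ k ≤ minSubcover (iteratedJoin f U (k * N)) := by
      rw [div_pow, div_le_iff₀ (pow_pos hn1 k), mul_comm]
      exact h1
    have h3 := Real.log_le_log (pow_pos (div_pos hn0 hn1) k) h2
    rw [Real.log_pow, ← hc] at h3
    have hk0 : (0 : ℝ) < k := by exact_mod_cast (by omega : 0 < k)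
    rw [Nat.cast_mul, div_le_div_iff₀ hNR (mul_pos hk0 hNR)]
    nlinarith
  have hlim : ((c / N : ℝ) : EReal) ≤ coverEntropy f U := by
    -- The bound is known only along multiples of `N`, which suffices for the upper limit.
    refine le_limsup_of_frequently_le ?_
    rw [frequently_atTop]
    intro a
    refine ⟨(a + 2) * N, ?_, EReal.coe_le_coe_iff.2 (hbound (a + 2) (by omega))⟩
    nlinarith
  refine lt_of_lt_of_le ?_ hlim
  exact_mod_cast div_pos hc0 hNR

/-- If no time is both a return time of `A` and a hitting time from `A` to `B`, then the
iterated joins of the cover by the complements of `A` and `B` have small subcovers: such a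
name is determined by the first visit to `A`. -/
theorem minSubcover_compl_le {A B : Set X}
    (hAB : Disjoint (hittingTimes f A A) (hittingTimes f A B)) (k : ℕ) :
    minSubcover (iteratedJoin f ![Aᶜ, Bᶜ] k) ≤ k + 1 := by
  classical
  -- Here `t` is the first visit to `A`, or `k` if there is none before `k`. Symbol 0 means outside
  -- `A` and 1 outside `B`: a return time of `A` never leads from `A` to `B`, and any other time
  -- never leads back to `A`.
  let w : ℕ → Fin k → Fin 2 := fun t j =>
    if (j : ℕ) < t then 0 else if (j : ℕ) - t ∈ hittingTimes f A A then 1 else 0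
  refine (minSubcover_le ((Finset.range (k + 1)).image w) ?_).trans
    (Finset.card_image_le.trans_eq (Finset.card_range _))
  refine eq_univ_of_forall fun x => ?_
  have hex : ∃ t, t ≤ k ∧ (∀ j < t, f^[j] x ∉ A) ∧ (t < k → f^[t] x ∈ A) := by
    by_cases hx : ∃ t, t < k ∧ f^[t] x ∈ A
    · refine ⟨Nat.find hx, (Nat.find_spec hx).1.le, fun j hj hjA => ?_,
        fun _ => (Nat.find_spec hx).2⟩
      exact Nat.find_min hx hj ⟨hj.trans (Nat.find_spec hx).1, hjA⟩
    · exact ⟨k, le_rfl, fun j hj hjA => hx ⟨j, hj, hjA⟩, fun h => absurd h (lt_irrefl k)⟩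
  obtain ⟨t, htk, hbefore, hat⟩ := hex
  refine mem_iUnion₂.2 ⟨w t, Finset.mem_image_of_mem w (Finset.mem_range.2 (by omega)),
    mem_iInter.2 fun j => ?_⟩
  rw [mem_preimage]
  by_cases hjt : (j : ℕ) < t
  · simpa [w, hjt] using hbefore j hjt
  have htA := hat (by omega)
  have hit : f^[(j : ℕ)] x = f^[(j : ℕ) - t] (f^[t] x) := by
    rw [← Function.iterate_add_apply, Nat.sub_add_cancel (by omega)]
  by_cases hmem : (j : ℕ) - t ∈ hittingTimes f A A
  · have : f^[(j : ℕ)] x ∉ B := fun hB =>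
      disjoint_left.1 hAB hmem ⟨_, htA, hit ▸ hB⟩
    simpa [w, hjt, hmem] using this
  · have : f^[(j : ℕ)] x ∉ A := fun hA => hmem ⟨_, htA, hit ▸ hA⟩
    simpa [w, hjt, hmem] using this

theorem coverEntropy_le_zero_of_minSubcover_le {ι : Type*} {U : ι → Set X}
    (h : ∀ k, minSubcover (iteratedJoin f U k) ≤ k + 1) : coverEntropy f U ≤ 0 := by
  have hlog : Tendsto (fun k : ℕ => Real.log ((k : ℝ) + 1) / k) atTop (𝓝 0) := by
    have h1 : Tendsto (fun x : ℝ => Real.log (x + 1) / x) atTop (𝓝 0) := by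
      have h2 : (fun x : ℝ => Real.log (x + 1)) =o[atTop] fun x : ℝ => x + 1 :=
        Real.isLittleO_log_id_atTop.comp_tendsto (tendsto_atTop_add_const_right _ 1 tendsto_id)
      have h3 : (fun x : ℝ => x + 1) =O[atTop] fun x : ℝ => x :=
        (Asymptotics.isBigO_refl _ _).add (Asymptotics.isLittleO_const_id_atTop 1).isBigO
      exact (h2.trans_isBigO h3).tendsto_div_nhds_zero
    exact h1.comp tendsto_natCast_atTop_atTop
  have hE : Tendsto (fun k : ℕ => ((Real.log ((k : ℝ) + 1) / k : ℝ) : EReal)) atTop (𝓝 0) :=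
    (continuous_coe_real_ereal.tendsto 0).comp hlog
  rw [← hE.limsup_eq]
  refine limsup_le_limsup (Eventually.of_forall fun k => EReal.coe_le_coe_iff.2 ?_)
  refine div_le_div_of_nonneg_right ?_ (Nat.cast_nonneg k)
  -- For the value 0, the convention `Real.log 0 = 0` gives the bound.
  rcases Nat.eq_zero_or_pos (minSubcover (iteratedJoin f U k)) with h0 | h0
  · rw [h0, Nat.cast_zero, Real.log_zero]
    exact Real.log_nonneg (by linarith [Nat.cast_nonneg (α := ℝ) k])
  · exact Real.log_le_log (by exact_mod_cast h0) (by exact_mod_cast h k)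

theorem UniformlyPositiveEntropyOfAllOrders.weaklyMixing {X : Type*} [MetricSpace X]
    [CompactSpace X] {f : X → X} (h : UniformlyPositiveEntropyOfAllOrders f) (hf : Continuous f)
    (hnw : NonWandering f) : WeaklyMixing f := by
  refine weaklyMixing_of_hittingTimes_inter hf (hnw.surjective hf) fun U V hU hV nU nV => ?_
  by_contra! hUV
  -- Otherwise `U` and `V` are the same singleton, and a return time of `U`, which exists by
  -- non-wandering, contradicts `hUV`.
  have hxy : ∃ x ∈ U, ∃ y ∈ V, x ≠ y := by
    by_contra! heq
    obtain ⟨x, hx⟩ := nU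
    obtain ⟨y, hy⟩ := nV
    have hx' : x ∈ nonWanderingSet f := hnw ▸ mem_univ x
    obtain ⟨k, hk, _, ⟨z, hz, rfl⟩, hz'⟩ := hx' U (hU.mem_nhds hx)
    exact hUV k hk ⟨z, hz, hz'⟩ ⟨z, hz, by rwa [heq _ hz' y hy]⟩
  obtain ⟨x, hx, y, hy, hne⟩ := hxy
  obtain ⟨r, hr, hsub, hdisj⟩ := exists_closedBall_subset_and_disjoint
    (U := ![U, V]) (p := ![x, y]) (by simp [Fin.forall_fin_two, hU, hV])
    (by simpa [Function.Injective, Fin.forall_fin_two] using ⟨hne, hne.symm⟩)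
    (by simp [Fin.forall_fin_two, hx, hy])
  set A := Metric.closedBall x r
  set B := Metric.closedBall y r
  have hAU : A ⊆ U := hsub 0
  have hBV : B ⊆ V := hsub 1
  have hAB : Disjoint A B := hdisj (zero_ne_one' (Fin 2))
  have hnd : ∀ z : X, ¬ Dense (Metric.closedBall z r)ᶜ := fun z hd => by
    rw [← interior_eq_empty_iff_dense_compl] at hd
    have : z ∈ interior (Metric.closedBall z r) :=
      Metric.ball_subset_interior_closedBall (Metric.mem_ball_self hr)
    simp [hd] at this
  have hpos := h 2 le_rfl ![Aᶜ, Bᶜ]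
    (by simp [Fin.forall_fin_two, A, B, Metric.isClosed_closedBall])
    (by simpa [Fin.forall_fin_two] using ⟨hnd x, hnd y⟩)
    (eq_univ_of_forall fun z => by
      by_cases hz : z ∈ A
      · exact mem_iUnion.2 ⟨1, disjoint_left.1 hAB hz⟩
      · exact mem_iUnion.2 ⟨0, hz⟩)
  refine hpos.not_ge (coverEntropy_le_zero_of_minSubcover_le (minSubcover_compl_le ?_))
  rw [disjoint_left]
  intro k hk hk'
  -- `hUV` concerns positive times; time 0 is excluded because `A` and `B` are disjoint.
  rcases Nat.eq_zero_or_pos k with rfl | hk0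
  · obtain ⟨z, hz, hz'⟩ := hk'
    exact disjoint_left.1 hAB hz hz'
  · exact hUV k hk0 (hittingTimes_mono hAU hAU hk) (hittingTimes_mono hAU hBV hk')

end Entropy

end TopDyn

theorem mainTheorem5 {X : Type*} [MetricSpace X] [CompactSpace X] [Nontrivial X]
    (f : X → X) (hf : Continuous f) (hnw : TopDyn.NonWandering f) (hsh : TopDyn.Shadowing f) :
    List.TFAE
      [TopDyn.WeaklyMixing f,
        TopDyn.HasFullShiftFactors f,
        TopDyn.StrongPropertyP f,
        TopDyn.UniformlyPositiveEntropyOfAllOrders f] := by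
  tfae_have 1 → 2 := fun h => h.hasFullShiftFactors hf hsh
  tfae_have 2 → 3 := fun h => h.strongPropertyP
  tfae_have 3 → 4 := fun h => h.uniformlyPositiveEntropyOfAllOrders
  tfae_have 4 → 1 := fun h => h.weaklyMixing hf hnw
  tfae_finish
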